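/- Let $k,r\ge 1$ be integers with $r\mid k$, put $\zeta=\max\{k/r,\,r\}$, and let $F$ be a finite field (for instance $\mathbb{F}_2$). Definitions. A linear code with encoding map $C\colon F^k\to F^n$ (linear and injective) supports a query $(x_{i_1},\dots,x_{i_t})$ with recovery sets of size at most $r$ if there are pairwise disjoint sets $R_1,\dots,R_t\subseteq[n]$ with $|R_a|\le r$ such that, for every $a$, the symbol $x_{i_a}$ is a function of the code symbols $C(x)_s$, $s\in R_a$. It is an $(n,k,r,t)$ batch code if there is a decoding map $D$ which, for each query $(i_1,\dots,i_t)\in[k]^t$ (repetitions allowed), is a linear map $F^n\to F^t$ sending $C(x)$ to $(x_{i_1},\dots,x_{i_t})$ for all $x\in F^k$, its $a$-th output depending only on the coordinates in $R_a$, for some pairwise disjoint sets $R_1,\dots,R_t$ of size at most $r$ each. It is systematic if $x$ is a sub-vector of $C(x)$. $\mathcal{B}(k,r,t)$ is the smallest length $n$ of a systematic linear $(n,k,r,t)$ batch code over $F$. Construction. Let $\mathbf{A}$ be the $k\times\frac kr$ matrix whose $j$-th column is $1$ in the rows $(j-1)r+1,\dots,jr$ and $0$ elsewhere. Call a $k\times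 2\zeta$ matrix $\mathbf{B}$ with entries in $\{0,1\}\subseteq F$ admissible if every column of $\mathbf{B}$ has weight $\min\{r,k/r\}$, every row of $\mathbf{B}$ has weight $2$, and $[\,\mathbf{A}\mid\mathbf{B}\,]$ contains no $1$-square, that is, among the four entries in any two distinct rows and any two distinct columns at least one is $0$. Proposition. Admissible matrices $\mathbf{B}$ exist. For every admissible $\mathbf{B}$, the code $x\mapsto x\mathbf{G}$ with generator matrix $\mathbf{G}=[\,\mathbf{I}_k\mid\mathbf{A}\mid\mathbf{B}\,]$ supports every query $(x_i,x_j,x_\ell,x_h)$, $i,j,\ell,h\in[k]$, with recovery sets of size at most $r$. Therefore it is a systematic linear $(n,k,r,4)$ batch code, of length $n=(r+1)\frac kr+2\zeta$. In particular, $$\mathcal{B}(k,r,4)\le (r+1)\frac kr+2\zeta .$$ -/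

import Mathlib

/-- `R` is a recovery set for the information symbol `x i` of the code with encoding map `C`:
the value of `x i` is a function of the code symbols with index in `R`. -/
def IsRecoverySet {Q ι : Type*} {k : ℕ} (C : (Fin k → Q) → (ι → Q)) (i : Fin k)
    (R : Finset ι) : Prop :=
  ∃ φ : (R → Q) → Q, ∀ x : Fin k → Q, φ (fun a => C x a) = x i

/-- The code supports the query `(x (q 1), …, x (q t))`: there are `t` respective pairwise disjoint
recovery sets, each of size at most `r`. -/
def SupportsQuery {Q ι : Type*} {k t : ℕ} (C : (Fin k → Q) → (ι → Q)) (r : ℕ)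
    (q : Fin t → Fin k) : Prop :=
  ∃ R : Fin t → Finset ι,
    (∀ a b, a ≠ b → Disjoint (R a) (R b)) ∧
    (∀ a, (R a).card ≤ r) ∧
    (∀ a, IsRecoverySet C (q a) (R a))

/-- `D` is a decoding map for the encoding map `C` and queries of size `t`: it returns the
queried symbols, and its `a`-th output is computed from the `a`-th of `t` pairwise disjoint sets of
at most `r` code symbols each. -/
def IsBatchDecoder {Q ι : Type*} {k t : ℕ} (C : (Fin k → Q) → (ι → Q)) (r : ℕ)
    (D : (Fin t → Fin k) → (ι → Q) → (Fin t → Q)) : Prop :=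
  (∀ (x : Fin k → Q) (q : Fin t → Fin k) (a : Fin t), D q (C x) a = x (q a)) ∧
  ∀ q : Fin t → Fin k, ∃ R : Fin t → Finset ι,
    (∀ a b, a ≠ b → Disjoint (R a) (R b)) ∧
    (∀ a, (R a).card ≤ r) ∧
    (∀ a (y y' : ι → Q), (∀ s ∈ R a, y s = y' s) → D q y a = D q y' a)

/-- A systematic linear batch code over the field `F`, of dimension `k`, with recovery sets of size
at most `r` and query size `t`; its length is the number of elements of the index type `ι`.
The encoding is linear and injective, the information vector is a sub-vector of its encoding, and
for each query the decoding map is linear. -/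
def IsSystematicLinearBatchCode {F : Type*} [Field F] {ι : Type*} {k : ℕ}
    (C : (Fin k → F) →ₗ[F] (ι → F)) (r t : ℕ) : Prop :=
  Function.Injective C ∧
  (∃ e : Fin k ↪ ι, ∀ (x : Fin k → F) (i : Fin k), C x (e i) = x i) ∧
  ∃ D : (Fin t → Fin k) → ((ι → F) →ₗ[F] (Fin t → F)), IsBatchDecoder C r (fun q y => D q y)

/-- The optimal length of a systematic linear batch code over `F` with parameters `k, r, t`
(the value is `⊤` if there is no such code). -/
noncomputable def optBatchLength (F : Type*) [Field F] (k r t : ℕ) : ℕ∞ :=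
  ⨅ (n : ℕ) (_ : ∃ C : (Fin k → F) →ₗ[F] (Fin n → F), IsSystematicLinearBatchCode C r t), (n : ℕ∞)

/-- `ζ = max {k / r, r}` (used for `r ∣ k`). -/
def zetaMax (k r : ℕ) : ℕ := max (k / r) r

/-- The `k × (k / r)` matrix whose `j`-th column is the indicator of the `j`-th block of `r`
consecutive rows (rows and columns are numbered from `0`). -/
def blockMatrix (F : Type*) [Field F] (k r : ℕ) : Matrix (Fin k) (Fin (k / r)) F :=
  Matrix.of fun i j => if (j : ℕ) * r ≤ (i : ℕ) ∧ (i : ℕ) < ((j : ℕ) + 1) * r then 1 else 0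

/-- There is no `1`-square in the `0/1` matrix `M`: of the four entries in two distinct rows and two
distinct columns, at least one is zero. -/
def NoOneSquare {F : Type*} [Field F] {m n : Type*} (M : Matrix m n F) : Prop :=
  ∀ (i₁ i₂ : m) (j₁ j₂ : n), i₁ ≠ i₂ → j₁ ≠ j₂ →
    M i₁ j₁ = 0 ∨ M i₁ j₂ = 0 ∨ M i₂ j₁ = 0 ∨ M i₂ j₂ = 0

/-- The rules for the last block `B` of the generator matrix `[I | A | B]`: it is a `0/1` matrix,
its columns have weight `min {r, k / r}`, its rows have weight `t - 2`, and `[A | B]` has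
no `1`-square. -/
def IsAdmissible {F : Type*} [Field F] [DecidableEq F] {k m : ℕ} (r t : ℕ)
    (B : Matrix (Fin k) (Fin m) F) : Prop :=
  (∀ i j, B i j = 0 ∨ B i j = 1) ∧
  (∀ j, hammingNorm (fun i => B i j) = min r (k / r)) ∧
  (∀ i, hammingNorm (fun j => B i j) = t - 2) ∧
  NoOneSquare (Matrix.fromCols (blockMatrix F k r) B)

/-- The generator matrix `G = [I | A | B]`. -/
def generatorMatrix {F : Type*} [Field F] {k m : ℕ} (r : ℕ) (B : Matrix (Fin k) (Fin m) F) :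
    Matrix (Fin k) (Fin k ⊕ (Fin (k / r) ⊕ Fin m)) F :=
  Matrix.fromCols 1 (Matrix.fromCols (blockMatrix F k r) B)

/-- The encoding map `x ↦ x G` of the code with generator matrix `G = [I | A | B]`. -/
def batchEncoder {F : Type*} [Field F] {k m : ℕ} (r : ℕ) (B : Matrix (Fin k) (Fin m) F) :
    (Fin k → F) →ₗ[F] (Fin k ⊕ (Fin (k / r) ⊕ Fin m) → F) :=
  (generatorMatrix r B).vecMulLinear

/-! Besides its systematic copy, `x i` can be recovered from each of the three columns of `[A | B]`
meeting row `i`: the parity symbol minus the other information symbols of the column. The size of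
such a set is the column weight, at most `r`. Without `1`-squares, two columns meeting in row `i`
meet in no other row, so these sets are disjoint and any other row lies in at most one of the three
columns. A case split on the multiplicities of the query then gives the recovery sets
(`linearlySupportsQuery_fromCols_one`).

For existence, `B` is the edge-vertex incidence matrix of a bipartite graph, regular of degree `min
r (k / r)`, with `ζ` vertices on each side. Absence of `1`-squares means that the graph is simple
and each block of `r` rows is a matching; a circulant graph achieves this
(`noOneSquare_block_circulant`).

Recovery is kept linear throughout, since the decoder must be linear and local on all words, not
only on codewords. -/

/-! ### Linear recovery sets and batch codes -/

/-- A linear functional on the codewords that reads only the symbols in `R` and returns `x i`. -/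
def IsLinearRecoverySet {F ι : Type*} [Field F] {k : ℕ} (C : (Fin k → F) →ₗ[F] (ι → F))
    (i : Fin k) (R : Finset ι) : Prop :=
  ∃ f : (ι → F) →ₗ[F] F, (∀ x, f (C x) = x i) ∧
    ∀ y y' : ι → F, (∀ s ∈ R, y s = y' s) → f y = f y'

/-- `t` pairwise disjoint linear recovery sets of size at most `r` for the query `q`. -/
def LinearlySupportsQuery {F ι : Type*} [Field F] {k t : ℕ} (C : (Fin k → F) →ₗ[F] (ι → F))
    (r : ℕ) (q : Fin t → Fin k) : Prop :=
  ∃ R : Fin t → Finset ι,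
    (∀ a b, a ≠ b → Disjoint (R a) (R b)) ∧
    (∀ a, (R a).card ≤ r) ∧
    (∀ a, IsLinearRecoverySet C (q a) (R a))

lemma IsLinearRecoverySet.isRecoverySet {F ι : Type*} [Field F] {k : ℕ}
    {C : (Fin k → F) →ₗ[F] (ι → F)} {i : Fin k} {R : Finset ι}
    (h : IsLinearRecoverySet C i R) : IsRecoverySet C i R := by
  classical
  obtain ⟨f, hf, hR⟩ := h
  -- The filler `0` off `R` is harmless, as `f` reads only `R`.
  refine ⟨fun z => f fun s => if h : s ∈ R then z ⟨s, h⟩ else 0, fun x => ?_⟩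
  rw [← hf x]
  refine hR _ _ fun s hs => ?_
  simp [hs]

lemma LinearlySupportsQuery.supportsQuery {F ι : Type*} [Field F] {k t r : ℕ}
    {C : (Fin k → F) →ₗ[F] (ι → F)} {q : Fin t → Fin k}
    (h : LinearlySupportsQuery C r q) : SupportsQuery C r q := by
  obtain ⟨R, hd, hc, hr⟩ := h
  exact ⟨R, hd, hc, fun a => (hr a).isRecoverySet⟩

lemma LinearlySupportsQuery.comp_perm {F ι : Type*} [Field F] {k t r : ℕ}
    {C : (Fin k → F) →ₗ[F] (ι → F)} {q : Fin t → Fin k}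
    (h : LinearlySupportsQuery C r q) (σ : Equiv.Perm (Fin t)) :
    LinearlySupportsQuery C r (q ∘ σ) := by
  obtain ⟨R, hd, hc, hr⟩ := h
  exact ⟨R ∘ σ, fun a b hab => hd _ _ (σ.injective.ne hab), fun a => hc _, fun a => hr _⟩

lemma isSystematicLinearBatchCode_of_linearlySupportsQuery {F ι : Type*} [Field F] {k t r : ℕ}
    {C : (Fin k → F) →ₗ[F] (ι → F)} (e : Fin k ↪ ι) (he : ∀ x i, C x (e i) = x i)
    (h : ∀ q : Fin t → Fin k, LinearlySupportsQuery C r q) :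
    IsSystematicLinearBatchCode C r t := by
  refine ⟨fun x y hxy => funext fun i => ?_, ⟨e, he⟩, ?_⟩
  · rw [← he x i, ← he y i, hxy]
  · choose R hd hc hr using h
    choose f hf hR using hr
    exact ⟨fun q => LinearMap.pi (f q), fun x q a => hf q a x,
      fun q => ⟨R q, hd q, hc q, fun a y y' hy => hR q a y y' hy⟩⟩

/-- Needed because `optBatchLength` ranges over codes indexed by `Fin n`, while the construction is
indexed by a sum type. -/
lemma IsSystematicLinearBatchCode.reindex {F ι κ : Type*} [Field F] {k t r : ℕ}
    {C : (Fin k → F) →ₗ[F] (ι → F)} (h : IsSystematicLinearBatchCode C r t) (σ : κ ≃ ι) :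
    IsSystematicLinearBatchCode (LinearMap.funLeft F F σ ∘ₗ C) r t := by
  classical
  obtain ⟨hinj, ⟨e, he⟩, D, hD, hR⟩ := h
  have key : ∀ y : ι → F, LinearMap.funLeft F F σ.symm (LinearMap.funLeft F F σ y) = y := by
    intro y; ext s; simp [LinearMap.funLeft_apply]
  refine ⟨fun x y hxy => hinj ?_, ⟨e.trans σ.symm.toEmbedding, fun x i => ?_⟩,
    fun q => D q ∘ₗ LinearMap.funLeft F F σ.symm, fun x q a => ?_, fun q => ?_⟩
  · rw [← key (C x), ← key (C y)]
    exact congrArg _ hxy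
  · simp [LinearMap.funLeft_apply, he]
  · simp only [LinearMap.comp_apply, key]
    exact hD x q a
  · obtain ⟨R, hd, hc, hf⟩ := hR q
    refine ⟨fun a => (R a).map σ.symm.toEmbedding, fun a b hab => ?_, fun a => ?_, ?_⟩
    · exact (Finset.disjoint_map _).2 (hd a b hab)
    · simpa using hc a
    · intro a y y' hy
      refine hf a _ _ fun s hs => ?_
      exact hy _ (Finset.mem_map_of_mem _ hs)

lemma optBatchLength_le_card {F ι : Type*} [Field F] [Fintype ι] {k t r : ℕ}
    {C : (Fin k → F) →ₗ[F] (ι → F)} (h : IsSystematicLinearBatchCode C r t) :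
    optBatchLength F k r t ≤ (Fintype.card ι : ℕ∞) :=
  iInf₂_le (Fintype.card ι) ⟨_, h.reindex (Fintype.equivFin ι).symm⟩

/-! ### Recovery from parity columns -/

section ParityColumns

variable {F γ : Type*} [Field F] {k r : ℕ}

lemma isLinearRecoverySet_singleton (M : Matrix (Fin k) γ F) (i : Fin k) :
    IsLinearRecoverySet (Matrix.fromCols 1 M).vecMulLinear i {Sum.inl i} := by
  refine ⟨LinearMap.proj (Sum.inl i), fun x => ?_, fun y y' h => h _ (by simp)⟩
  simp [Matrix.vecMul_fromCols]

lemma NoOneSquare.eq_zero_or {M : Matrix (Fin k) γ F} (hM : NoOneSquare M) {i : Fin k} {c d : γ}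
    (hcd : c ≠ d) (hc : M i c ≠ 0) (hd : M i d ≠ 0) {m : Fin k} (hm : m ≠ i) :
    M m c = 0 ∨ M m d = 0 := by
  have := hM i m c d hm.symm hcd
  tauto

lemma linearlySupportsQuery_four {ι : Type*} {C : (Fin k → F) →ₗ[F] (ι → F)} {i j l h : Fin k}
    {R₁ R₂ R₃ R₄ : Finset ι}
    (d12 : Disjoint R₁ R₂) (d13 : Disjoint R₁ R₃) (d14 : Disjoint R₁ R₄)
    (d23 : Disjoint R₂ R₃) (d24 : Disjoint R₂ R₄) (d34 : Disjoint R₃ R₄)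
    (c1 : R₁.card ≤ r) (c2 : R₂.card ≤ r) (c3 : R₃.card ≤ r) (c4 : R₄.card ≤ r)
    (r1 : IsLinearRecoverySet C i R₁) (r2 : IsLinearRecoverySet C j R₂)
    (r3 : IsLinearRecoverySet C l R₃) (r4 : IsLinearRecoverySet C h R₄) :
    LinearlySupportsQuery C r ![i, j, l, h] := by
  refine ⟨![R₁, R₂, R₃, R₄], ?_, ?_, ?_⟩
  · intro a b hab
    fin_cases a <;> fin_cases b <;> first | exact absurd rfl hab | assumption | (apply Disjoint.symm; assumption)
  · intro a; fin_cases a <;> assumption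
  · intro a; fin_cases a <;> assumption

/-- Adjacent transpositions reduce each multiplicity pattern of a query to a single ordering. -/
lemma LinearlySupportsQuery.swap12 {ι : Type*} {C : (Fin k → F) →ₗ[F] (ι → F)} {i j l h : Fin k}
    (H : LinearlySupportsQuery C r ![i, j, l, h]) : LinearlySupportsQuery C r ![j, i, l, h] := by
  convert H.comp_perm (Equiv.swap 0 1) using 1
  ext a; fin_cases a <;> rfl

lemma LinearlySupportsQuery.swap23 {ι : Type*} {C : (Fin k → F) →ₗ[F] (ι → F)} {i j l h : Fin k}
    (H : LinearlySupportsQuery C r ![i, j, l, h]) : LinearlySupportsQuery C r ![i, l, j, h] := by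
  convert H.comp_perm (Equiv.swap 1 2) using 1
  ext a; fin_cases a <;> rfl

lemma LinearlySupportsQuery.swap34 {ι : Type*} {C : (Fin k → F) →ₗ[F] (ι → F)} {i j l h : Fin k}
    (H : LinearlySupportsQuery C r ![i, j, l, h]) : LinearlySupportsQuery C r ![i, j, h, l] := by
  convert H.comp_perm (Equiv.swap 2 3) using 1
  ext a; fin_cases a <;> rfl

variable [DecidableEq F] [DecidableEq γ]

/-- The code symbols used to recover `x i` from the parity symbol of column `c` of `M`. -/
def colRecovery (M : Matrix (Fin k) γ F) (i : Fin k) (c : γ) : Finset (Fin k ⊕ γ) :=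
  insert (Sum.inr c) (((Finset.univ.filter fun i' => M i' c ≠ 0).erase i).map
    Function.Embedding.inl)

lemma card_colRecovery {M : Matrix (Fin k) γ F} {i : Fin k} {c : γ} (hi : M i c ≠ 0) :
    (colRecovery M i c).card = hammingNorm fun i' => M i' c := by
  have hmem : i ∈ Finset.univ.filter fun i' => M i' c ≠ 0 := by simp [hi]
  rw [colRecovery, Finset.card_insert_of_notMem (by simp), Finset.card_map,
    Finset.card_erase_add_one hmem]
  rfl

lemma isLinearRecoverySet_colRecovery {M : Matrix (Fin k) γ F} (hM : ∀ i c, M i c = 0 ∨ M i c = 1)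
    {i : Fin k} {c : γ} (hi : M i c ≠ 0) :
    IsLinearRecoverySet (Matrix.fromCols 1 M).vecMulLinear i (colRecovery M i c) := by
  refine ⟨LinearMap.proj (Sum.inr c) -
    ∑ i' ∈ (Finset.univ.filter fun i' => M i' c ≠ 0).erase i, LinearMap.proj (Sum.inl i'),
    fun x => ?_, fun y y' h => ?_⟩
  · have hmem : i ∈ Finset.univ.filter fun i' => M i' c ≠ 0 := by simp [hi]
    have hsum : (Matrix.vecMul x M) c = ∑ i' ∈ Finset.univ.filter (fun i' => M i' c ≠ 0), x i' := by
      rw [Matrix.vecMul, dotProduct, Finset.sum_filter]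
      refine Finset.sum_congr rfl fun i' _ => ?_
      rcases hM i' c with h | h <;> simp [h]
    simp only [LinearMap.sub_apply, LinearMap.proj_apply, LinearMap.sum_apply,
      Matrix.vecMulLinear_apply, Matrix.vecMul_fromCols, Sum.elim_inl, Sum.elim_inr,
      Matrix.vecMul_one, hsum]
    rw [← Finset.add_sum_erase _ _ hmem, add_sub_cancel_right]
  · simp only [LinearMap.sub_apply, LinearMap.proj_apply, LinearMap.sum_apply]
    rw [h (Sum.inr c) (Finset.mem_insert_self _ _)]
    congr 1
    refine Finset.sum_congr rfl fun i' hi' => h _ ?_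
    exact Finset.mem_insert_of_mem (Finset.mem_map_of_mem _ hi')

lemma disjoint_singleton_colRecovery {M : Matrix (Fin k) γ F} {i j : Fin k} {c : γ}
    (h : j = i ∨ M j c = 0) : Disjoint {Sum.inl j} (colRecovery M i c) := by
  rw [Finset.disjoint_singleton_left]
  simp only [colRecovery, Finset.mem_insert, Finset.mem_map, Finset.mem_erase, Finset.mem_filter]
  rcases h with rfl | h
  · simp
  · simp [h]

lemma disjoint_colRecovery {M : Matrix (Fin k) γ F} {i j : Fin k} {c d : γ} (hcd : c ≠ d)
    (h : ∀ m, m ≠ i → m ≠ j → M m c = 0 ∨ M m d = 0) :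
    Disjoint (colRecovery M i c) (colRecovery M j d) := by
  rw [Finset.disjoint_left]
  rintro (m | m) h1 h2
  · simp [colRecovery] at h1 h2
    rcases h m h1.1 h2.1 with h | h
    · exact h1.2 h
    · exact h2.2 h
  · simp [colRecovery] at h1 h2
    exact hcd (h1.symm.trans h2)

/-- The columns already meet in row `i`, hence nowhere else, and the first set omits `x i`. Allowing
`j ≠ i` serves two queried symbols in one block. -/
lemma NoOneSquare.disjoint_colRecovery {M : Matrix (Fin k) γ F} (hM : NoOneSquare M) {i j : Fin k}
    {c d : γ} (hcd : c ≠ d) (hc : M i c ≠ 0) (hd : M i d ≠ 0) :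
    Disjoint (colRecovery M i c) (colRecovery M j d) :=
  _root_.disjoint_colRecovery hcd fun _ hm _ => hM.eq_zero_or hcd hc hd hm

/-- If every row of a `0/1` matrix `M` without `1`-squares has three ones, one of which lies in the
column `blk i`, no row has ones in two of the columns `blk i`, and all columns have weight at most
`r`, then the code with generator matrix `[I | M]` supports all queries of size four. -/
lemma linearlySupportsQuery_fromCols_one (hr : 0 < r) {M : Matrix (Fin k) γ F}
    (hM : ∀ i c, M i c = 0 ∨ M i c = 1) (hsq : NoOneSquare M)
    (hw : ∀ c, hammingNorm (fun i => M i c) ≤ r) (blk : Fin k → γ)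
    (hblk : ∀ i j, M i (blk j) ≠ 0 ↔ blk i = blk j)
    (hrow : ∀ i, ∃ c d, c ≠ d ∧ blk i ≠ c ∧ blk i ≠ d ∧ M i c ≠ 0 ∧ M i d ≠ 0)
    (i j l h : Fin k) :
    LinearlySupportsQuery (Matrix.fromCols (1 : Matrix (Fin k) (Fin k) F) M).vecMulLinear r
      ![i, j, l, h] := by
  set C := (Matrix.fromCols (1 : Matrix (Fin k) (Fin k) F) M).vecMulLinear
  have hb : ∀ i, M i (blk i) ≠ 0 := fun i => (hblk i i).2 rfl
  have c0 : ∀ i : Fin k, ({Sum.inl i} : Finset (Fin k ⊕ γ)).card ≤ r := fun i => by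
    rwa [Finset.card_singleton]
  have c1 : ∀ {i c}, M i c ≠ 0 → (colRecovery M i c).card ≤ r := fun h =>
    (card_colRecovery h).trans_le (hw _)
  have r0 : ∀ i, IsLinearRecoverySet C i {Sum.inl i} := isLinearRecoverySet_singleton M
  have r1 : ∀ {i c}, M i c ≠ 0 →
      IsLinearRecoverySet C i (colRecovery M i c) := fun h =>
    isLinearRecoverySet_colRecovery hM h
  have d0 : ∀ {i j : Fin k}, i ≠ j → Disjoint ({Sum.inl i} : Finset (Fin k ⊕ γ)) {Sum.inl j} :=
    fun h => by simpa using h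
  have d1 : ∀ i c, Disjoint {Sum.inl i} (colRecovery M i c) := fun i c =>
    disjoint_singleton_colRecovery (Or.inl rfl)
  have d2 : ∀ {i j c}, M j c = 0 → Disjoint {Sum.inl j} (colRecovery M i c) := fun h =>
    disjoint_singleton_colRecovery (Or.inr h)
  have p1111 : ∀ i j l h : Fin k, i ≠ j → i ≠ l → i ≠ h → j ≠ l → j ≠ h → l ≠ h →
      LinearlySupportsQuery C r ![i, j, l, h] :=
    fun i j l h hij hil hih hjl hjh hlh =>
      linearlySupportsQuery_four (d0 hij) (d0 hil) (d0 hih) (d0 hjl) (d0 hjh) (d0 hlh)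
        (c0 i) (c0 j) (c0 l) (c0 h) (r0 i) (r0 j) (r0 l) (r0 h)
  have p4 : ∀ i : Fin k,
      LinearlySupportsQuery C r ![i, i, i, i] := by
    intro i
    obtain ⟨c, d, hcd, hbc, hbd, hc, hd⟩ := hrow i
    exact linearlySupportsQuery_four (d1 i (blk i)) (d1 i c) (d1 i d)
      (hsq.disjoint_colRecovery hbc (hb i) hc) (hsq.disjoint_colRecovery hbd (hb i) hd)
      (hsq.disjoint_colRecovery hcd hc hd) (c0 i) (c1 (hb i)) (c1 hc) (c1 hd)
      (r0 i) (r1 (hb i)) (r1 hc) (r1 hd)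
  have p31 : ∀ i j : Fin k, i ≠ j →
      LinearlySupportsQuery C r ![i, i, i, j] := by
    intro i j hij
    -- Row `j` lies in at most one of the three columns through `i`, so two columns avoid it.
    obtain ⟨c, d, hcd, hc, hd, hjc, hjd⟩ :
        ∃ c d, c ≠ d ∧ M i c ≠ 0 ∧ M i d ≠ 0 ∧ M j c = 0 ∧ M j d = 0 := by
      obtain ⟨c, d, hcd, hbc, hbd, hc, hd⟩ := hrow i
      have h1 := hsq.eq_zero_or hbc (hb i) hc hij.symm
      have h2 := hsq.eq_zero_or hbd (hb i) hd hij.symm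
      have h3 := hsq.eq_zero_or hcd hc hd hij.symm
      by_cases h4 : M j (blk i) = 0
      · rcases h3 with h3 | h3
        · exact ⟨_, _, hbc, hb i, hc, h4, h3⟩
        · exact ⟨_, _, hbd, hb i, hd, h4, h3⟩
      · exact ⟨c, d, hcd, hc, hd, h1.resolve_left h4, h2.resolve_left h4⟩
    exact linearlySupportsQuery_four (d1 i c) (d1 i d) (d0 hij)
      (hsq.disjoint_colRecovery hcd hc hd) (d2 hjc).symm (d2 hjd).symm
      (c0 i) (c1 hc) (c1 hd) (c0 j) (r0 i) (r1 hc) (r1 hd) (r0 j)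
  have p211 : ∀ i j l : Fin k, i ≠ j → i ≠ l → j ≠ l →
      LinearlySupportsQuery C r ![i, i, j, l] := by
    intro i j l hij hil hjl
    -- Rows `j` and `l` each spoil at most one of the three columns through `i`.
    obtain ⟨c, hc, hjc, hlc⟩ : ∃ c, M i c ≠ 0 ∧ M j c = 0 ∧ M l c = 0 := by
      obtain ⟨c, d, hcd, hbc, hbd, hc, hd⟩ := hrow i
      have h1 := hsq.eq_zero_or hbc (hb i) hc hij.symm
      have h2 := hsq.eq_zero_or hbd (hb i) hd hij.symm
      have h3 := hsq.eq_zero_or hcd hc hd hij.symm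
      have h1' := hsq.eq_zero_or hbc (hb i) hc hil.symm
      have h2' := hsq.eq_zero_or hbd (hb i) hd hil.symm
      have h3' := hsq.eq_zero_or hcd hc hd hil.symm
      by_contra! H
      have := H _ (hb i)
      have := H _ hc
      have := H _ hd
      tauto
    exact linearlySupportsQuery_four (d1 i c) (d0 hij) (d0 hil) (d2 hjc).symm (d2 hlc).symm
      (d0 hjl) (c0 i) (c1 hc) (c0 j) (c0 l) (r0 i) (r1 hc) (r0 j) (r0 l)
  have p22 : ∀ i j : Fin k, i ≠ j →
      LinearlySupportsQuery C r ![i, i, j, j] := by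
    intro i j hij
    -- In a common block, the block column recovers `x j` at the cost of the systematic copy of `x
    -- i`, so `x i` uses its two other columns. In different blocks, the two block columns have
    -- disjoint supports.
    by_cases hblock : blk i = blk j
    · obtain ⟨c, d, hcd, hbc, hbd, hc, hd⟩ := hrow i
      have hj : M j (blk i) ≠ 0 := (hblk j i).2 hblock.symm
      have hjc := (hsq.eq_zero_or hbc (hb i) hc hij.symm).resolve_left hj
      have hjd := (hsq.eq_zero_or hbd (hb i) hd hij.symm).resolve_left hj
      exact linearlySupportsQuery_four (hsq.disjoint_colRecovery hcd hc hd) (d2 hjc).symm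
        (hsq.disjoint_colRecovery hbc.symm hc (hb i)) (d2 hjd).symm
        (hsq.disjoint_colRecovery hbd.symm hd (hb i)) (d1 j (blk i))
        (c1 hc) (c1 hd) (c0 j) (c1 hj) (r1 hc) (r1 hd) (r0 j) (r1 hj)
    · have hij' : M i (blk j) = 0 := by simpa [hblock] using hblk i j
      have hji' : M j (blk i) = 0 := by simpa [Ne.symm hblock] using hblk j i
      refine linearlySupportsQuery_four (d1 i (blk i)) (d0 hij) (d2 hij') (d2 hji').symm
        (disjoint_colRecovery hblock fun m _ _ => ?_) (d1 j (blk j))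
        (c0 i) (c1 (hb i)) (c0 j) (c1 (hb j)) (r0 i) (r1 (hb i)) (r0 j) (r1 (hb j))
      by_contra! H
      exact hblock (((hblk m i).1 H.1).symm.trans ((hblk m j).1 H.2))
  by_cases hij : i = j
  · subst hij
    by_cases hil : i = l
    · subst hil
      by_cases hih : i = h
      · subst hih; exact p4 i
      · exact p31 i h hih
    · by_cases hih : i = h
      · subst hih; exact (p31 i l hil).swap34
      · by_cases hlh : l = h
        · subst hlh; exact p22 i l hil
        · exact p211 i l h hil hih hlh
  · by_cases hil : i = l
    · subst hil
      by_cases hih : i = h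
      · subst hih; exact (p31 i j hij).swap34.swap23
      · by_cases hjh : j = h
        · subst hjh; exact (p22 i j hij).swap23
        · exact (p211 i j h hij hih hjh).swap23
    · by_cases hih : i = h
      · subst hih
        by_cases hjl : j = l
        · subst hjl; exact (p22 i j hij).swap23.swap34
        · exact (p211 i j l hij hil hjl).swap23.swap34
      · by_cases hjl : j = l
        · subst hjl
          by_cases hjh : j = h
          · subst hjh; exact (p31 j i (Ne.symm hij)).swap34.swap23.swap12
          · exact (p211 j i h (Ne.symm hij) hjh hih).swap23.swap12
        · by_cases hjh : j = h
          · subst hjh; exact (p211 j i l (Ne.symm hij) hjl hil).swap23.swap12.swap34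
          · by_cases hlh : l = h
            · subst hlh
              exact (p211 l i j (Ne.symm hil) (Ne.symm hjl) hij).swap23.swap34.swap12.swap23
            · exact p1111 i j l h hij hil hih hjl hjh hlh

end ParityColumns

/-! ### Codes from admissible matrices -/

lemma blockMatrix_ne_zero_iff {F : Type*} [Field F] {k r : ℕ} (hr : 0 < r) (i : Fin k)
    (j : Fin (k / r)) : blockMatrix F k r i j ≠ 0 ↔ (i : ℕ) / r = j := by
  rw [blockMatrix, Matrix.of_apply, Nat.div_eq_iff hr, Nat.le_sub_one_iff_lt (by positivity)]
  simp only [ne_eq, ite_eq_right_iff, one_ne_zero, imp_false, not_not, add_mul, one_mul]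

lemma hammingNorm_blockMatrix_le {F : Type*} [Field F] [DecidableEq F] {k r : ℕ}
    (j : Fin (k / r)) : hammingNorm (fun i => blockMatrix F k r i j) ≤ r := by
  have : (Finset.univ.filter fun i => blockMatrix F k r i j ≠ 0).card ≤
      (Finset.Ico ((j : ℕ) * r) (((j : ℕ) + 1) * r)).card := by
    refine Finset.card_le_card_of_injOn (fun i => (i : ℕ)) (fun i hi => ?_)
      (Fin.val_injective.injOn)
    simpa [blockMatrix] using hi
  rw [Nat.card_Ico, add_mul, one_mul, Nat.add_sub_cancel_left] at this
  exact this

lemma IsAdmissible.linearlySupportsQuery {F : Type*} [Field F] [DecidableEq F] {k m r : ℕ}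
    (hr : 0 < r) (hrk : r ∣ k) {B : Matrix (Fin k) (Fin m) F} (hB : IsAdmissible r 4 B)
    (i j l h : Fin k) : LinearlySupportsQuery (batchEncoder r B) r ![i, j, l, h] := by
  obtain ⟨h01, hcol, hrow, hsq⟩ := hB
  have hlt : ∀ i : Fin k, (i : ℕ) / r < k / r := fun i => Nat.div_lt_div_of_lt_of_dvd hrk i.2
  refine linearlySupportsQuery_fromCols_one hr (M := Matrix.fromCols (blockMatrix F k r) B)
    ?_ hsq ?_ (fun i => Sum.inl ⟨(i : ℕ) / r, hlt i⟩) ?_ ?_ i j l h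
  · rintro i (c | c)
    · simp only [Matrix.fromCols_apply_inl, blockMatrix, Matrix.of_apply]
      split_ifs <;> simp
    · simpa using h01 i c
  · rintro (c | c)
    · simpa using hammingNorm_blockMatrix_le c
    · simpa only [Matrix.fromCols_apply_inr] using (hcol c).trans_le (min_le_left _ _)
  · intro i j
    rw [Matrix.fromCols_apply_inl, blockMatrix_ne_zero_iff hr]
    simp
  · intro i
    obtain ⟨c, d, hcd, hset⟩ := Finset.card_eq_two.1 (hrow i)
    have hc : B i c ≠ 0 := by
      have : c ∈ ({c, d} : Finset (Fin m)) := by simp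
      rw [← hset] at this
      simpa using this
    have hd : B i d ≠ 0 := by
      have : d ∈ ({c, d} : Finset (Fin m)) := by simp
      rw [← hset] at this
      simpa using this
    exact ⟨Sum.inr c, Sum.inr d, by simpa using hcd, by simp, by simp, by simpa using hc,
      by simpa using hd⟩

/-! ### A circulant bipartite graph gives an admissible matrix -/

/-- Row `e` is the edge joining vertex `e % z` of one side to vertex `(e + e / z) % z` of the other
side of a bipartite graph with `z` vertices on each side. -/
def circulantIncidence (F : Type*) [Field F] (k z : ℕ) : Matrix (Fin k) (Fin (2 * z)) F :=
  Matrix.of fun e j =>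
    if (j : ℕ) = (e : ℕ) % z ∨ (j : ℕ) = z + ((e : ℕ) + (e : ℕ) / z) % z then 1 else 0

lemma circulantIncidence_ne_zero_iff {F : Type*} [Field F] {k z : ℕ} (e : Fin k)
    (j : Fin (2 * z)) : circulantIncidence F k z e j ≠ 0 ↔
      (j : ℕ) = (e : ℕ) % z ∨ (j : ℕ) = z + ((e : ℕ) + (e : ℕ) / z) % z := by
  simp only [circulantIncidence, Matrix.of_apply, ne_eq, ite_eq_right_iff, one_ne_zero, imp_false,
    not_not]

lemma hammingNorm_circulantIncidence_row {F : Type*} [Field F] [DecidableEq F] {k z : ℕ}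
    (hz : 0 < z) (e : Fin k) : hammingNorm (fun j => circulantIncidence F k z e j) = 2 := by
  have h1 := Nat.mod_lt (e : ℕ) hz
  have h2 := Nat.mod_lt ((e : ℕ) + (e : ℕ) / z) hz
  have : (Finset.univ.filter fun j => circulantIncidence F k z e j ≠ 0) =
      {⟨(e : ℕ) % z, by omega⟩, ⟨z + ((e : ℕ) + (e : ℕ) / z) % z, by omega⟩} := by
    ext j
    simp [circulantIncidence_ne_zero_iff, Fin.ext_iff]
  rw [hammingNorm, this, Finset.card_pair]
  simp only [ne_eq, Fin.mk.injEq]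
  omega

/-- The edges with a fixed value `d` of `e / z` form a perfect matching, `u` being joined to `u + d`
mod `z`, and there are `m` such layers. -/
lemma hammingNorm_circulantIncidence_col {F : Type*} [Field F] [DecidableEq F] {k m z : ℕ}
    (hz : 0 < z) (hk : k = m * z) (hmz : m ≤ z) (j : Fin (2 * z)) :
    hammingNorm (fun e => circulantIncidence F k z e j) = m := by
  have key : (Finset.univ.filter fun e => circulantIncidence F k z e j ≠ 0).card =
      (Finset.range m).card := by
    refine Finset.card_bij (fun e _ => (e : ℕ) / z) (fun e _ => ?_) (fun e he e' he' hq => ?_)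
      (fun d hd => ?_)
    · rw [Finset.mem_range, Nat.div_lt_iff_lt_mul hz, ← hk]
      exact e.2
    · simp only [Finset.mem_filter, Finset.mem_univ, true_and,
        circulantIncidence_ne_zero_iff] at he he'
      have h1 := Nat.mod_lt (e : ℕ) hz
      have h1' := Nat.mod_lt (e' : ℕ) hz
      have hmod : (e : ℕ) % z = (e' : ℕ) % z := by
        rcases he with he | he <;> rcases he' with he' | he'
        · omega
        · omega
        · omega
        · have h3 : ((e : ℕ) + (e : ℕ) / z) % z = ((e' : ℕ) + (e : ℕ) / z) % z := by
            rw [hq] at he ⊢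
            omega
          exact Nat.ModEq.add_right_cancel' _ h3
      refine Fin.ext ?_
      rw [← Nat.div_add_mod (e : ℕ) z, ← Nat.div_add_mod (e' : ℕ) z, hq, hmod]
    · rw [Finset.mem_range] at hd
      have hlt : ∀ u, u < z → z * d + u < k := fun u hu => by
        have : z * (d + 1) ≤ z * m := Nat.mul_le_mul_left z hd
        rw [hk, mul_comm m]
        rw [mul_add] at this
        omega
      have hdiv : ∀ u, u < z → (z * d + u) / z = d := fun u hu => by
        rw [Nat.mul_add_div hz, Nat.div_eq_of_lt hu, add_zero]
      by_cases hj : (j : ℕ) < z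
      · refine ⟨⟨z * d + j, hlt _ hj⟩, ?_, hdiv _ hj⟩
        simp only [Finset.mem_filter, Finset.mem_univ, true_and, circulantIncidence_ne_zero_iff]
        left
        rw [Nat.mul_add_mod, Nat.mod_eq_of_lt hj]
      -- The left endpoint solves `u + d ≡ j - z` mod `z`; `z - d` stands for `-d`, where `d < m ≤
      -- z`.
      · have hu := Nat.mod_lt ((j : ℕ) - z + (z - d)) hz
        refine ⟨⟨z * d + ((j : ℕ) - z + (z - d)) % z, hlt _ hu⟩, ?_, hdiv _ hu⟩
        simp only [Finset.mem_filter, Finset.mem_univ, true_and, circulantIncidence_ne_zero_iff]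
        right
        have hj2 := j.2
        rw [hdiv _ hu, add_assoc, Nat.mul_add_mod, Nat.mod_add_mod,
          show (j : ℕ) - z + (z - d) + d = (j : ℕ) - z + z by omega, Nat.add_mod_right,
          Nat.mod_eq_of_lt (by omega)]
        omega
  rw [hammingNorm, key, Finset.card_range]

lemma eq_of_div_eq_of_shift_mod_eq {a b r z : ℕ} (hr : 0 < r) (hrz : r ≤ z)
    (hdiv : a / r = b / r) (hmod : (a + a / z) % z = (b + b / z) % z) : a = b := by
  wlog hab : a ≤ b generalizing a b
  · exact (this hdiv.symm hmod.symm (by omega)).symm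
  have ha := Nat.div_add_mod a r
  have hb := Nat.div_add_mod b r
  have ha' := Nat.mod_lt a hr
  have hb' := Nat.mod_lt b hr
  rw [hdiv] at ha
  have hlt : b < a + r := by omega
  have hmono : a / z ≤ b / z := Nat.div_le_div_right hab
  have hstep : b / z ≤ a / z + 1 := by
    calc b / z ≤ (a + z) / z := Nat.div_le_div_right (by omega)
      _ = a / z + 1 := Nat.add_div_right _ (by omega)
  have hdvd : z ∣ (b + b / z) - (a + a / z) :=
    (Nat.modEq_iff_dvd' (by omega)).1 hmod
  -- The shifted difference is at most `(r - 1) + 1 = r`, which is too small when `r < z`. When `r =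
  -- z`, `hdiv` gives equal quotients by `z`, so the extra `1` disappears.
  obtain hrz | rfl := hrz.lt_or_eq
  · have := Nat.eq_zero_of_dvd_of_lt hdvd (by omega)
    omega
  · have := Nat.eq_zero_of_dvd_of_lt hdvd (by omega)
    omega

/-- The graph is simple: the two endpoints determine `a / z` mod `z`, and the quotients lie below `m
≤ z`. -/
lemma eq_of_mod_eq_of_shift_mod_eq {a b m z : ℕ} (hmz : m ≤ z) (ha : a < m * z) (hb : b < m * z)
    (hmod : a % z = b % z) (hshift : (a + a / z) % z = (b + b / z) % z) : a = b := by
  have hz : 0 < z := Nat.pos_of_ne_zero (by rintro rfl; simp at ha)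
  have h1 : a / z < m := (Nat.div_lt_iff_lt_mul hz).2 ha
  have h2 : b / z < m := (Nat.div_lt_iff_lt_mul hz).2 hb
  have h3 : a / z ≡ b / z [MOD z] := Nat.ModEq.add_left_cancel hmod hshift
  have h4 : a / z = b / z := Nat.ModEq.eq_of_lt_of_lt h3 (by omega) (by omega)
  rw [← Nat.div_add_mod a z, ← Nat.div_add_mod b z, h4, hmod]

lemma eq_of_div_eq_of_mod_eq {a b r z : ℕ} (hr : 0 < r) (hrz : r ≤ z)
    (hdiv : a / r = b / r) (hmod : a % z = b % z) : a = b := by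
  wlog hab : a ≤ b generalizing a b
  · exact (this hdiv.symm hmod.symm (by omega)).symm
  have ha := Nat.div_add_mod a r
  have hb := Nat.div_add_mod b r
  have ha' := Nat.mod_lt a hr
  have hb' := Nat.mod_lt b hr
  rw [hdiv] at ha
  have := Nat.eq_zero_of_dvd_of_lt ((Nat.modEq_iff_dvd' hab).1 hmod) (by omega)
  omega

lemma noOneSquare_block_circulant {F : Type*} [Field F] {k r m z : ℕ} (hr : 0 < r) (hrz : r ≤ z)
    (hmz : m ≤ z) (hk : k = m * z) :
    NoOneSquare (Matrix.fromCols (blockMatrix F k r) (circulantIncidence F k z)) := by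
  intro e f c d hef hcd
  by_contra! H
  obtain ⟨hec, hed, hfc, hfd⟩ := H
  have hz : 0 < z := by omega
  have hne : (e : ℕ) ≠ f := fun h => hef (Fin.ext h)
  have he1 := Nat.mod_lt (e : ℕ) hz
  have hf1 := Nat.mod_lt (f : ℕ) hz
  have he2 := Nat.mod_lt ((e : ℕ) + (e : ℕ) / z) hz
  have hf2 := Nat.mod_lt ((f : ℕ) + (f : ℕ) / z) hz
  -- Two edges of one block share no vertex, on either side.
  have hmixed : ∀ (c : Fin (k / r)) (d : Fin (2 * z)), blockMatrix F k r e c ≠ 0 →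
      blockMatrix F k r f c ≠ 0 → circulantIncidence F k z e d ≠ 0 →
      circulantIncidence F k z f d ≠ 0 → False := by
    intro c d hec hfc hed hfd
    rw [blockMatrix_ne_zero_iff hr] at hec hfc
    rw [circulantIncidence_ne_zero_iff] at hed hfd
    have hdiv := hec.trans hfc.symm
    rcases hed with hed | hed <;> rcases hfd with hfd | hfd
    · exact hne (eq_of_div_eq_of_mod_eq hr hrz hdiv (by omega))
    · omega
    · omega
    · exact hne (eq_of_div_eq_of_shift_mod_eq hr hrz hdiv (by omega))
  rcases c with c | c <;> rcases d with d | d <;>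
    simp only [Matrix.fromCols_apply_inl, Matrix.fromCols_apply_inr] at hec hed hfc hfd
  · rw [blockMatrix_ne_zero_iff hr] at hec hed
    exact hcd (congrArg _ (Fin.ext (hec.symm.trans hed)))
  · exact hmixed c d hec hfc hed hfd
  · exact hmixed d c hed hfd hec hfc
  · rw [circulantIncidence_ne_zero_iff] at hec hed hfc hfd
    have hcd' : (c : ℕ) ≠ d := fun h => hcd (congrArg _ (Fin.ext h))
    -- Distinct columns of `B` through one edge are its two endpoints, so `e` and `f` are parallel
    -- edges.
    exact hne (eq_of_mod_eq_of_shift_mod_eq hmz (hk ▸ e.2) (hk ▸ f.2) (by omega) (by omega))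

lemma isAdmissible_circulantIncidence {F : Type*} [Field F] [DecidableEq F] {k r : ℕ}
    (hr : 0 < r) (hrk : r ∣ k) : IsAdmissible r 4 (circulantIncidence F k (zetaMax k r)) := by
  have hrz : r ≤ zetaMax k r := le_max_right _ _
  have hmz : min r (k / r) ≤ zetaMax k r := (min_le_left _ _).trans hrz
  have hk : k = min r (k / r) * zetaMax k r := by
    rw [zetaMax, max_comm, min_mul_max, Nat.mul_div_cancel' hrk]
  refine ⟨fun e j => ?_, fun j => ?_, fun e => ?_, ?_⟩
  · simp only [circulantIncidence, Matrix.of_apply]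
    split_ifs <;> simp
  · exact hammingNorm_circulantIncidence_col (hr.trans_le hrz) hk hmz j
  · exact hammingNorm_circulantIncidence_row (hr.trans_le hrz) e
  · exact noOneSquare_block_circulant hr hrz hmz hk

/-! ### The batch code and its length -/

lemma IsAdmissible.isSystematicLinearBatchCode {F : Type*} [Field F] [DecidableEq F] {k m r : ℕ}
    (hr : 0 < r) (hrk : r ∣ k) {B : Matrix (Fin k) (Fin m) F} (hB : IsAdmissible r 4 B) :
    IsSystematicLinearBatchCode (batchEncoder r B) r 4 := by
  refine isSystematicLinearBatchCode_of_linearlySupportsQuery Function.Embedding.inl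
    (fun x i => ?_) fun q => ?_
  · simp [batchEncoder, generatorMatrix, Matrix.vecMul_fromCols]
  · convert hB.linearlySupportsQuery hr hrk (q 0) (q 1) (q 2) (q 3) using 1
    ext a; fin_cases a <;> rfl

lemma card_codeSymbols {k r m : ℕ} (hrk : r ∣ k) :
    Fintype.card (Fin k ⊕ (Fin (k / r) ⊕ Fin m)) = (r + 1) * (k / r) + m := by
  simp only [Fintype.card_sum, Fintype.card_fin]
  rw [add_mul, Nat.mul_div_cancel' hrk, one_mul, add_assoc]

theorem mainTheorem7 {F : Type*} [Field F] [Fintype F] [DecidableEq F] (k r : ℕ)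
    (hk : 0 < k) (hr : 0 < r) (hrk : r ∣ k) :
    (∃ B : Matrix (Fin k) (Fin (2 * zetaMax k r)) F, IsAdmissible r 4 B) ∧
    (∀ B : Matrix (Fin k) (Fin (2 * zetaMax k r)) F, IsAdmissible r 4 B →
      (∀ i j l h : Fin k, SupportsQuery (batchEncoder r B) r ![i, j, l, h]) ∧
      IsSystematicLinearBatchCode (batchEncoder r B) r 4 ∧
      Fintype.card (Fin k ⊕ (Fin (k / r) ⊕ Fin (2 * zetaMax k r))) =
        (r + 1) * (k / r) + 2 * zetaMax k r) ∧
    optBatchLength F k r 4 ≤ (((r + 1) * (k / r) + 2 * zetaMax k r : ℕ) : ℕ∞) := by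
  refine ⟨⟨_, isAdmissible_circulantIncidence hr hrk⟩, fun B hB => ⟨fun i j l h => ?_, ?_, ?_⟩, ?_⟩
  · exact (hB.linearlySupportsQuery hr hrk i j l h).supportsQuery
  · exact hB.isSystematicLinearBatchCode hr hrk
  · exact card_codeSymbols hrk
  · rw [← card_codeSymbols hrk]
    exact optBatchLength_le_card
      ((isAdmissible_circulantIncidence (F := F) hr hrk).isSystematicLinearBatchCode hr hrk)
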